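/- Let $a>0$, and for $i=1,2$ let $\alpha_i,\beta_i\ge 0$ with $\alpha_i+\beta_i=1$. Consider the complex Banach spaces $L^1(-1,0)$ and $L^1(0,1)$ (Lebesgue measure), and let $K_1:L^1(-1,0)\to L^1(0,1)$ and $K_2:L^1(0,1)\to L^1(-1,0)$ be weakly compact linear operators which are stochastic, i.e. they map nonnegative functions to nonnegative functions and satisfy $\|K_i f\|=\|f\|$ for all $f\ge 0$. Let $R_1:L^1(-1,0)\to L^1(0,1)$ and $R_2:L^1(0,1)\to L^1(-1,0)$ be the reflections $(R_i\varphi)(v)=\varphi(-v)$, and put $O_i=\alpha_iR_i+\beta_iK_i$. For $\lambda\in\mathbb{C}$ with $\operatorname{Re}\lambda\ge 0$ define the bounded operator $G_\lambda$ on $L^1(0,1)$ by $$G_\lambda f=O_1\Big(e^{-\frac{2\lambda a}{|v|}}\,O_2\big(e^{-\frac{2\lambda a}{|v|}}f\big)\Big),$$ where $e^{-2\lambda a/|v|}$ denotes multiplication by the function $v\mapsto e^{-2\lambda a/|v|}$. If $\beta_1+\beta_2>0$, then the spectral radius of $G_\lambda$ satisfies $$r_\sigma(G_\lambda)<1\qquad\text{for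 all }\lambda\in\mathbb{C}\text{ with }\operatorname{Re}\lambda\ge 0,\ \lambda\neq 0.$$ -/

import Mathlib

open MeasureTheory Set
open scoped ENNReal

namespace SlabTransport

/-- The complex Banach space `L¹(I; dv)` for a set `I` of real numbers. -/
abbrev L1 (I : Set ℝ) : Type := Lp ℂ 1 (volume.restrict I)

/-- The interval `(-1, 0)`. -/
abbrev negI : Set ℝ := Ioo (-1) 0

/-- The interval `(0, 1)`. -/
abbrev posI : Set ℝ := Ioo 0 1

/-- `f` belongs to the positive cone of `L¹(I)`: it takes nonnegative real values a.e. -/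
def InCone {I : Set ℝ} (f : L1 I) : Prop :=
  ∀ᵐ v ∂(volume.restrict I), 0 ≤ (f v).re ∧ (f v).im = 0

/-- A stochastic operator: positive, and norm preserving on the positive cone. -/
def IsStochastic {I J : Set ℝ} (K : L1 I →L[ℂ] L1 J) : Prop :=
  ∀ f : L1 I, InCone f → InCone (K f) ∧ ‖K f‖ = ‖f‖

/-- A weakly compact operator: the image of the closed unit ball is relatively compact
for the weak topology of the target. -/
def IsWeaklyCompactOperator {E F : Type*} [NormedAddCommGroup E] [NormedSpace ℂ E]
    [NormedAddCommGroup F] [NormedSpace ℂ F] (K : E →L[ℂ] F) : Prop :=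
  IsCompact (closure (toWeakSpace ℂ F '' (K '' Metric.closedBall 0 1)))

theorem measurePreserving_neg_pos_neg :
    MeasurePreserving (fun v : ℝ => -v) (volume.restrict posI) (volume.restrict negI) := by
  have h := (Measure.measurePreserving_neg (volume : Measure ℝ)).restrict_preimage
    (s := negI) measurableSet_Ioo
  have e : (Neg.neg : ℝ → ℝ) ⁻¹' negI = posI := by
    ext v
    simp only [negI, posI, mem_preimage, mem_Ioo]
    constructor <;> rintro ⟨h1, h2⟩ <;> constructor <;> linarith
  rw [e] at h
  exact h

theorem measurePreserving_neg_neg_pos :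
    MeasurePreserving (fun v : ℝ => -v) (volume.restrict negI) (volume.restrict posI) := by
  have h := (Measure.measurePreserving_neg (volume : Measure ℝ)).restrict_preimage
    (s := posI) measurableSet_Ioo
  have e : (Neg.neg : ℝ → ℝ) ⁻¹' posI = negI := by
    ext v
    simp only [negI, posI, mem_preimage, mem_Ioo]
    constructor <;> rintro ⟨h1, h2⟩ <;> constructor <;> linarith
  rw [e] at h
  exact h

/-- The specular reflection `(R₁ φ)(v) = φ(-v)` from `L¹(-1, 0)` to `L¹(0, 1)`. -/
noncomputable def R₁ : L1 negI →L[ℂ] L1 posI :=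
  (Lp.compMeasurePreservingₗᵢ ℂ (fun v : ℝ => -v)
    measurePreserving_neg_pos_neg).toContinuousLinearMap

/-- The specular reflection `(R₂ φ)(v) = φ(-v)` from `L¹(0, 1)` to `L¹(-1, 0)`. -/
noncomputable def R₂ : L1 posI →L[ℂ] L1 negI :=
  (Lp.compMeasurePreservingₗᵢ ℂ (fun v : ℝ => -v)
    measurePreserving_neg_neg_pos).toContinuousLinearMap

/-- The boundary operator `O₁ = α R₁ + β K` at `x = -a`. -/
noncomputable def O₁ (α β : ℝ) (K : L1 negI →L[ℂ] L1 posI) : L1 negI →L[ℂ] L1 posI :=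
  (α : ℂ) • R₁ + (β : ℂ) • K

/-- The boundary operator `O₂ = α R₂ + β K` at `x = a`. -/
noncomputable def O₂ (α β : ℝ) (K : L1 posI →L[ℂ] L1 negI) : L1 posI →L[ℂ] L1 negI :=
  (α : ℂ) • R₂ + (β : ℂ) • K

/-- The function `v ↦ exp (-2 λ a / |v|)`. -/
noncomputable def decay (a : ℝ) (lam : ℂ) (v : ℝ) : ℂ :=
  Complex.exp (-(2 * lam * a / (|v| : ℝ)))

theorem norm_decay_le {a : ℝ} (ha : 0 < a) {lam : ℂ} (hlam : 0 ≤ lam.re) (v : ℝ) :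
    ‖decay a lam v‖ ≤ 1 := by
  have h : (2 * lam * a / ((|v| : ℝ) : ℂ)).re = 2 * lam.re * a / |v| := by
    rw [Complex.div_ofReal_re]
    simp
  rw [decay, Complex.norm_exp, Complex.neg_re, h, Real.exp_le_one_iff]
  have : 0 ≤ 2 * lam.re * a / |v| := by positivity
  linarith

theorem memLp_decay {a : ℝ} (ha : 0 < a) {lam : ℂ} (hlam : 0 ≤ lam.re) (I : Set ℝ) :
    MemLp (decay a lam) ∞ (volume.restrict I) := by
  refine memLp_top_of_bound ?_ 1 (ae_of_all _ (norm_decay_le ha hlam))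
  apply Measurable.aestronglyMeasurable
  unfold decay
  fun_prop

/-- The multiplication operator by `exp (-2 λ a / |v|)` on `L¹(I)`, for `a > 0`, `Re λ ≥ 0`. -/
noncomputable def decayMul {a : ℝ} (ha : 0 < a) {lam : ℂ} (hlam : 0 ≤ lam.re) (I : Set ℝ) :
    L1 I →L[ℂ] L1 I :=
  (ContinuousLinearMap.mul ℂ ℂ).holderL (volume.restrict I) ∞ 1 1
    ((memLp_decay ha hlam I).toLp (decay a lam))

theorem coeFn_decayMul {a : ℝ} (ha : 0 < a) {lam : ℂ} (hlam : 0 ≤ lam.re) (I : Set ℝ)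
    (f : L1 I) :
    decayMul ha hlam I f =ᵐ[volume.restrict I] fun v => decay a lam v * f v := by
  have h := (ContinuousLinearMap.mul ℂ ℂ).coeFn_holder (r := 1)
    ((memLp_decay ha hlam I).toLp (decay a lam)) f
  filter_upwards [h, (memLp_decay ha hlam I).coeFn_toLp] with v h1 h2
  rw [h2] at h1
  exact h1

/-- `G_λ f = O₁ (exp (-2 λ a / |v|) O₂ (exp (-2 λ a / |v|) f))` as an operator on `L¹(0, 1)`,
where `O₁ = α₁ R₁ + β₁ K₁` and `O₂ = α₂ R₂ + β₂ K₂`. -/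
noncomputable def G {a : ℝ} (ha : 0 < a) (α₁ β₁ α₂ β₂ : ℝ)
    (K₁ : L1 negI →L[ℂ] L1 posI) (K₂ : L1 posI →L[ℂ] L1 negI)
    {lam : ℂ} (hlam : 0 ≤ lam.re) : L1 posI →L[ℂ] L1 posI :=
  (O₁ α₁ β₁ K₁).comp ((decayMul ha hlam negI).comp
    ((O₂ α₂ β₂ K₂).comp (decayMul ha hlam posI)))

end SlabTransport

/-! For `Re λ > 0` the multiplier on `(0, 1)` is bounded by `e^{-2 a Re λ} < 1` and the other
factors are contractions, so `‖G‖ < 1`.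

On the imaginary axis the multiplier is unimodular and norm can be lost only by cancellation. Weak
compactness makes a stochastic `K` spreading: it cannot put nearly all its mass into a set of small
measure (`IsStochastic.isSpreading`). Mixing with a reflection keeps this property as long as `β >
0`.

The core is `norm_comp_mul_comp_lt_one`: for spreading stochastic `O`, `O'` and a unimodular
multiplier `n` with null level sets, `‖O n O'‖ < 1`. If a spreading operator loses almost no norm,
the phases of its input and of its output lie, up to little mass, near boundedly many points of the
circle (`IsSpreading.exists_cluster`). Were `‖O n O' f‖` close to 1, this would hold for the phases
of both `u = O' f` and `n u`, so `n`, the quotient of the two phases, would be close to one of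
boundedly many values on most of the mass of `u`. But `n` is close to these values only on a set of
small measure, where `O' f` cannot concentrate.

If one boundary operator is a pure reflection, it commutes with the multiplier, and the same
argument applies to `G²` with `2λ` in place of `λ`. -/

namespace SlabTransport

open Filter Topology

/-! ### Stochastic and spreading operators on `L¹`. -/

/-- Restriction of integrable functions to a set `B`. -/
noncomputable abbrev restr (J B : Set ℝ) :
    L1 J →L[ℂ] Lp ℂ 1 ((volume.restrict J).restrict B) :=
  LpToLpRestrictCLM ℝ ℂ ℂ (volume.restrict J) 1 B

/-- An operator into `L¹(J)` which does not concentrate mass: a fixed proportion of the mass of the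
image lies outside any set of small measure. -/
def IsSpreading {I J : Set ℝ} (O : L1 I →L[ℂ] L1 J) : Prop :=
  ∃ δ : ℝ≥0∞, 0 < δ ∧ ∃ θ : ℝ, θ < 1 ∧ ∀ B, MeasurableSet B → volume.restrict J B < δ →
    ∀ h, ‖restr J B (O h)‖ ≤ θ * ‖h‖

theorem norm_restr {J : Set ℝ} (B : Set ℝ) (f : L1 J) :
    ‖restr J B f‖ = ∫ v in B, ‖f v‖ ∂(volume.restrict J) := by
  rw [L1.norm_eq_integral_norm]
  refine integral_congr_ae ?_
  filter_upwards [LpToLpRestrictCLM_coeFn ℂ B f] with v hv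
  rw [hv]

theorem norm_restr_le {J : Set ℝ} (B : Set ℝ) (f : L1 J) : ‖restr J B f‖ ≤ ‖f‖ := by
  rw [norm_restr, L1.norm_eq_integral_norm]
  exact setIntegral_le_integral (L1.integrable_coeFn f).norm
    (ae_of_all _ fun v => norm_nonneg _)

theorem InCone.coeFn_eq {I : Set ℝ} {f : L1 I} (hf : InCone f) :
    f =ᵐ[volume.restrict I] fun v => ((‖f v‖ : ℝ) : ℂ) := by
  filter_upwards [hf] with v hv
  have h : f v = ((f v).re : ℂ) := by
    apply Complex.ext <;> simp [hv.2]
  rw [h, Complex.norm_real, Real.norm_of_nonneg hv.1]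

theorem inCone_toLp {I : Set ℝ} {f : ℝ → ℝ} (hf : ∀ v, 0 ≤ f v)
    (h : MemLp (fun v => (f v : ℂ)) 1 (volume.restrict I)) : InCone (h.toLp _) := by
  filter_upwards [h.coeFn_toLp] with v hv
  rw [hv]
  exact ⟨by simpa using hf v, by simp⟩

/-- On `L¹`, a bound on the positive cone implies the same bound everywhere. -/
theorem norm_le_of_forall_inCone {I : Set ℝ} {F : Type*} [NormedAddCommGroup F] [NormedSpace ℂ F]
    (S : L1 I →L[ℂ] F) {θ : ℝ} (hS : ∀ f, InCone f → ‖S f‖ ≤ θ * ‖f‖) (f : L1 I) :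
    ‖S f‖ ≤ θ * ‖f‖ := by
  induction f using Lp.induction ENNReal.one_ne_top with
  | indicatorConst c hs hμs =>
    rename_i s
    rw [Lp.simpleFunc.coe_indicatorConst]
    have h1 : InCone (indicatorConstLp (μ := volume.restrict I) 1 hs hμs.ne (1 : ℂ)) := by
      filter_upwards [indicatorConstLp_coeFn (μ := volume.restrict I) (p := 1) (hs := hs)
        (hμs := hμs.ne) (c := (1 : ℂ))] with v hv
      rw [hv]
      by_cases h : v ∈ s <;> simp [h]
    have h2 : indicatorConstLp (μ := volume.restrict I) 1 hs hμs.ne c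
        = c • indicatorConstLp (μ := volume.restrict I) 1 hs hμs.ne (1 : ℂ) := by
      apply Lp.ext
      filter_upwards [indicatorConstLp_coeFn (μ := volume.restrict I) (p := 1) (hs := hs)
        (hμs := hμs.ne) (c := (1 : ℂ)), indicatorConstLp_coeFn (μ := volume.restrict I) (p := 1)
        (hs := hs) (hμs := hμs.ne) (c := c), Lp.coeFn_smul c
        (indicatorConstLp (μ := volume.restrict I) 1 hs hμs.ne (1 : ℂ))] with v h2 h3 h4
      rw [h3, h4, Pi.smul_apply, h2]
      by_cases h : v ∈ s <;> simp [h]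
    rw [h2, map_smul, norm_smul, norm_smul]
    nlinarith [hS _ h1, norm_nonneg c]
  | add hf hg hd h1 h2 =>
    rename_i f g
    -- Disjoint supports make the `L¹` norm additive, so the bounds for the two summands add without
    -- loss.
    have e : ‖hf.toLp f + hg.toLp g‖ = ‖hf.toLp f‖ + ‖hg.toLp g‖ := by
      simp only [L1.norm_eq_integral_norm]
      rw [← integral_add (L1.integrable_coeFn _).norm (L1.integrable_coeFn _).norm]
      refine integral_congr_ae ?_
      filter_upwards [Lp.coeFn_add (hf.toLp f) (hg.toLp g), hf.coeFn_toLp, hg.coeFn_toLp]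
        with v h1 h2 h3
      rw [h1, Pi.add_apply, h2, h3]
      by_cases h : f v = 0
      · simp [h]
      · have : g v = 0 := by
          by_contra h'
          exact Set.disjoint_left.1 hd h h'
        simp [this]
    rw [map_add, e]
    linarith [norm_add_le (S (hf.toLp f)) (S (hg.toLp g))]
  | isClosed => exact isClosed_le (by fun_prop) (by fun_prop)

theorem IsStochastic.norm_le {I J : Set ℝ} {K : L1 I →L[ℂ] L1 J} (hK : IsStochastic K)
    (f : L1 I) : ‖K f‖ ≤ ‖f‖ := by
  simpa using norm_le_of_forall_inCone K (θ := 1) (fun f hf => by simp [(hK f hf).2]) f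

theorem IsStochastic.comp {I J L : Set ℝ} {K : L1 J →L[ℂ] L1 L} {K' : L1 I →L[ℂ] L1 J}
    (hK : IsStochastic K) (hK' : IsStochastic K') : IsStochastic (K.comp K') := fun f hf =>
  ⟨(hK _ (hK' f hf).1).1, ((hK _ (hK' f hf).1).2).trans (hK' f hf).2⟩

theorem norm_add_of_inCone {I : Set ℝ} {f g : L1 I} (hf : InCone f) (hg : InCone g) :
    ‖f + g‖ = ‖f‖ + ‖g‖ := by
  simp only [L1.norm_eq_integral_norm]
  rw [← integral_add (L1.integrable_coeFn _).norm (L1.integrable_coeFn _).norm]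
  refine integral_congr_ae ?_
  filter_upwards [Lp.coeFn_add f g, hf.coeFn_eq, hg.coeFn_eq] with v h1 h2 h3
  rw [h1, Pi.add_apply, h2, h3, ← Complex.ofReal_add]
  simp only [Complex.norm_real, norm_norm]
  rw [Real.norm_of_nonneg (by positivity)]

theorem InCone.smul {I : Set ℝ} {f : L1 I} (hf : InCone f) {c : ℝ} (hc : 0 ≤ c) :
    InCone ((c : ℂ) • f) := by
  filter_upwards [hf, Lp.coeFn_smul (c : ℂ) f] with v h1 h2
  rw [h2]
  simp only [Pi.smul_apply, smul_eq_mul, Complex.re_ofReal_mul, Complex.im_ofReal_mul, h1.2,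
    mul_zero, and_true]
  exact mul_nonneg hc h1.1

theorem InCone.add {I : Set ℝ} {f g : L1 I} (hf : InCone f) (hg : InCone g) :
    InCone (f + g) := by
  filter_upwards [hf, hg, Lp.coeFn_add f g] with v h1 h2 h3
  rw [h3]
  simp only [Pi.add_apply, Complex.add_re, Complex.add_im, h1.2, h2.2, add_zero, and_true]
  exact add_nonneg h1.1 h2.1

theorem IsStochastic.convex {I J : Set ℝ} {R K : L1 I →L[ℂ] L1 J} (hR : IsStochastic R)
    (hK : IsStochastic K) {α β : ℝ} (hα : 0 ≤ α) (hβ : 0 ≤ β) (h : α + β = 1) :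
    IsStochastic ((α : ℂ) • R + (β : ℂ) • K) := by
  intro f hf
  have h1 := (hR f hf).1.smul hα
  have h2 := (hK f hf).1.smul hβ
  refine ⟨h1.add h2, ?_⟩
  change ‖(α : ℂ) • R f + (β : ℂ) • K f‖ = _
  rw [norm_add_of_inCone h1 h2, norm_smul, norm_smul, (hR f hf).2, (hK f hf).2, Complex.norm_real,
    Complex.norm_real, Real.norm_of_nonneg hα, Real.norm_of_nonneg hβ, ← add_mul, h, one_mul]

theorem IsSpreading.convex {I J : Set ℝ} {R K : L1 I →L[ℂ] L1 J} (hR : IsStochastic R)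
    (hK : IsSpreading K) {α β : ℝ} (hα : 0 ≤ α) (hβ : 0 < β) (h : α + β = 1) :
    IsSpreading ((α : ℂ) • R + (β : ℂ) • K) := by
  obtain ⟨δ, hδ, θ, hθ, H⟩ := hK
  -- `R` may send all its mass into `B`; only the share `β` of `K` is known to spread.
  refine ⟨δ, hδ, α + β * θ, by nlinarith, fun B hB hBδ f => ?_⟩
  change ‖restr J B ((α : ℂ) • R f + (β : ℂ) • K f)‖ ≤ _
  rw [map_add, map_smul, map_smul]
  refine (norm_add_le _ _).trans ?_
  rw [norm_smul, norm_smul, Complex.norm_real, Complex.norm_real, Real.norm_of_nonneg hα,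
    Real.norm_of_nonneg hβ.le]
  have h1 := (norm_restr_le B (R f)).trans (hR.norm_le f)
  have h2 := H B hB hBδ f
  nlinarith

theorem IsSpreading.comp {I J L : Set ℝ} {K : L1 J →L[ℂ] L1 L} {K' : L1 I →L[ℂ] L1 J}
    (hK : IsSpreading K) (hK' : IsStochastic K') : IsSpreading (K.comp K') := by
  obtain ⟨δ, hδ, θ, hθ, H⟩ := hK
  refine ⟨δ, hδ, max θ 0, by simp [hθ], fun B hB hBδ f => ?_⟩
  calc _ ≤ θ * ‖K' f‖ := H B hB hBδ (K' f)
    _ ≤ max θ 0 * ‖K' f‖ := by gcongr; exact le_max_left _ _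
    _ ≤ _ := by gcongr; exact hK'.norm_le f

/-- A weakly compact stochastic operator is spreading: otherwise a weak cluster point of a sequence
of concentrating images would charge a null set. -/
theorem IsStochastic.isSpreading {I J : Set ℝ} {K : L1 I →L[ℂ] L1 J} (hK : IsStochastic K)
    (hw : IsWeaklyCompactOperator K) : IsSpreading K := by
  suffices H : ∃ δ : ℝ≥0∞, 0 < δ ∧ ∀ B, MeasurableSet B → volume.restrict J B < δ →
      ∀ h, InCone h → ‖restr J B (K h)‖ ≤ (1 / 2 : ℝ) * ‖h‖ by
    obtain ⟨δ, hδ, H⟩ := H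
    exact ⟨δ, hδ, 1 / 2, by norm_num, fun B hB hBδ h =>
      norm_le_of_forall_inCone ((restr J B).comp K) (H B hB hBδ) h⟩
  by_contra! H
  have hpos : ∀ n : ℕ, (0 : ℝ≥0∞) < (1 / 2) ^ n := fun n => by
    apply ENNReal.pow_pos; simp
  choose B hB hBn h hh hbig using fun n : ℕ => H ((1 / 2) ^ n) (hpos n)
  have hh0 : ∀ n, 0 < ‖h n‖ := fun n => by
    by_contra h0
    have h1 : h n = 0 := by simpa using h0
    have := hbig n
    rw [h1] at this
    simp at this
  let g : ℕ → L1 I := fun n => (((‖h n‖⁻¹ : ℝ) : ℂ)) • h n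
  have hgc : ∀ n, InCone (g n) := fun n => (hh n).smul (by positivity)
  have hg1 : ∀ n, ‖g n‖ = 1 := fun n => by
    simp only [g, norm_smul, Complex.norm_real, norm_inv, norm_norm]
    exact inv_mul_cancel₀ (hh0 n).ne'
  have hgbig : ∀ n, 1 / 2 < ‖restr J (B n) (K (g n))‖ := fun n => by
    simp only [g, map_smul, norm_smul, Complex.norm_real, norm_inv, norm_norm]
    have := hbig n
    rw [inv_mul_eq_div, lt_div_iff₀ (hh0 n)]
    exact this
  -- A tail union contains every later `B n`, so the single functional `∫_{D m}` is at least `1/2`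
  -- on all later images. Such a bound passes to weak cluster points, while the measure of `D m` is
  -- at most `2 · 2⁻ᵐ`.
  let D : ℕ → Set ℝ := fun m => ⋃ n, B (n + m)
  let ℓ : ℕ → (L1 J →L[ℂ] ℂ) := fun m => (L1.integralCLM' ℂ).comp (restr J (D m))
  have hℓ : ∀ m f, ℓ m f = ∫ v in D m, f v ∂(volume.restrict J) := fun m f => by
    change L1.integralCLM' ℂ (restr J (D m) f) = _
    rw [← L1.integral_eq' ℂ, L1.integral_eq_integral]
    exact integral_congr_ae (LpToLpRestrictCLM_coeFn ℂ _ f)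
  have hℓbig : ∀ m n, m ≤ n → 1 / 2 ≤ (ℓ m (K (g n))).re := fun m n hmn => by
    have hc := (hK _ (hgc n)).1
    rw [hℓ, integral_congr_ae (ae_restrict_of_ae hc.coeFn_eq), integral_complex_ofReal, Complex.ofReal_re]
    refine (hgbig n).le.trans ?_
    rw [norm_restr]
    refine setIntegral_mono_set (L1.integrable_coeFn _).norm.integrableOn
      (ae_of_all _ fun v => norm_nonneg _) (LE.le.eventuallyLE ?_)
    intro v hv
    exact mem_iUnion.2 ⟨n - m, by rwa [Nat.sub_add_cancel hmn]⟩
  obtain ⟨y, -, hy⟩ := hw.exists_mapClusterPt (f := atTop)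
    (u := fun n => toWeakSpace ℂ (L1 J) (K (g n))) (by
      rw [le_principal_iff]
      refine Filter.mem_map.2 (univ_mem' fun n => subset_closure ?_)
      exact ⟨_, ⟨g n, by simp [hg1], rfl⟩, rfl⟩)
  have hcont : ∀ m, Continuous fun x : WeakSpace ℂ (L1 J) => ℓ m ((toWeakSpace ℂ (L1 J)).symm x) :=
    fun m => WeakBilin.eval_continuous (topDualPairing ℂ (L1 J)).flip (ℓ m)
  have hybig : ∀ m, 1 / 2 ≤ (ℓ m ((toWeakSpace ℂ (L1 J)).symm y)).re := fun m => by
    -- A half-space of a continuous functional is weakly closed, so a cluster point suffices and no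
    -- subsequence is extracted.
    have hcl : IsClosed {x : WeakSpace ℂ (L1 J) |
        1 / 2 ≤ (ℓ m ((toWeakSpace ℂ (L1 J)).symm x)).re} :=
      isClosed_le continuous_const (Complex.continuous_re.comp (hcont m))
    refine hcl.mem_of_mapClusterPt hy ?_
    filter_upwards [eventually_ge_atTop m] with n hn
    simpa using hℓbig m n hn
  have hD : Tendsto (volume.restrict J ∘ D) atTop (𝓝 0) := by
    have hle : ∀ m, (volume.restrict J ∘ D) m ≤ 2 * (1 / 2) ^ m := fun m => by
      calc (volume.restrict J) (D m) ≤ ∑' n, volume.restrict J (B (n + m)) := measure_iUnion_le _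
        _ ≤ ∑' n, (1 / 2 : ℝ≥0∞) ^ (n + m) := ENNReal.tsum_le_tsum fun n => (hBn _).le
        _ = 2 * (1 / 2) ^ m := by
          simp_rw [pow_add]
          rw [ENNReal.tsum_mul_right, ENNReal.tsum_geometric]
          simp
    refine tendsto_of_tendsto_of_tendsto_of_le_of_le tendsto_const_nhds ?_ (fun _ => zero_le)
      hle
    have := ENNReal.Tendsto.const_mul (a := 2)
      (ENNReal.tendsto_pow_atTop_nhds_zero_of_lt_one (r := 1 / 2) (by simp))
      (Or.inr (by simp))
    simpa using this
  -- Absolute continuity of the integral of the one function `y` contradicts the lower bound `1/2`.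
  have hlim := (L1.integrable_coeFn ((toWeakSpace ℂ (L1 J)).symm y)).tendsto_setIntegral_nhds_zero
    hD
  have hlim2 : Tendsto (fun m => (ℓ m ((toWeakSpace ℂ (L1 J)).symm y)).re) atTop (𝓝 0) := by
    simp_rw [hℓ]
    exact (Complex.continuous_re.tendsto _).comp hlim
  have := ge_of_tendsto' hlim2 hybig
  norm_num at this

/-! ### Phases and their discretization. -/

/-- The phase `z / |z|` of a complex number, with value `0` at `0`. -/
noncomputable def phase (z : ℂ) : ℂ := z / (‖z‖ : ℝ)

theorem norm_phase_le (z : ℂ) : ‖phase z‖ ≤ 1 := by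
  simp only [phase, norm_div, Complex.norm_real, norm_norm]
  exact div_self_le_one _

theorem norm_phase {z : ℂ} (hz : z ≠ 0) : ‖phase z‖ = 1 := by
  simp only [phase, norm_div, Complex.norm_real, norm_norm]
  exact div_self (norm_ne_zero_iff.2 hz)

theorem phase_mul_norm (z : ℂ) : phase z * (‖z‖ : ℝ) = z := by
  by_cases hz : z = 0
  · simp [hz]
  · exact div_mul_cancel₀ _ (by simpa using hz)

theorem phase_mul {w : ℂ} (hw : ‖w‖ = 1) (z : ℂ) : phase (w * z) = w * phase z := by
  simp [phase, hw, mul_div_assoc]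

theorem conj_phase_mul (z : ℂ) : (starRingEnd ℂ) (phase z) * z = (‖z‖ : ℝ) := by
  by_cases hz : z = 0
  · simp [hz]
  · have : ((‖z‖ : ℝ) : ℂ) ≠ 0 := by simpa using hz
    rw [phase, map_div₀, Complex.conj_ofReal, div_mul_eq_mul_div, mul_comm, Complex.mul_conj',
      sq, mul_div_assoc, div_self this, mul_one]

theorem measurable_phase : Measurable phase := by
  unfold phase
  fun_prop

/-- A measurable discretization of the unit circle. -/
theorem exists_simpleFunc_circle {η : ℝ} (hη : 0 < η) :
    ∃ q : SimpleFunc ℂ ℂ, (∀ z, ‖q z‖ = 1) ∧ ∀ z, ‖z‖ = 1 → ‖q z - z‖ ≤ η := by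
  obtain ⟨t, hts, htf, hcov⟩ := finite_cover_balls_of_compact (isCompact_sphere (0 : ℂ) 1) hη
  have hne : t.Nonempty := by
    have h1 := hcov (show (1 : ℂ) ∈ Metric.sphere (0 : ℂ) 1 by simp)
    simp only [mem_iUnion] at h1
    obtain ⟨x, hx, -⟩ := h1
    exact ⟨x, hx⟩
  obtain ⟨e, he⟩ := htf.countable.exists_eq_range hne
  have h1 : ∀ x : t, ∃ k, e k = x := fun x => he.subset x.2
  choose k hk using h1
  have : Finite t := htf
  obtain ⟨N, hN⟩ := (Set.finite_range k).bddAbove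
  -- `N` exceeds an index of every centre of the finite cover, so the nearest point among the first
  -- ones is at least as near as any centre.
  refine ⟨SimpleFunc.nearestPt e N, fun z => ?_, fun z hz => ?_⟩
  · have : SimpleFunc.nearestPt e N z ∈ t := by
      rw [he]
      exact ⟨_, rfl⟩
    simpa using hts this
  · have h1 := hcov (show z ∈ Metric.sphere (0 : ℂ) 1 by simpa using hz)
    simp only [mem_iUnion] at h1
    obtain ⟨x, hx, hxz⟩ := h1
    have h2 := SimpleFunc.edist_nearestPt_le e z (hN ⟨⟨x, hx⟩, rfl⟩)
    rw [hk, edist_dist, edist_dist, ENNReal.ofReal_le_ofReal_iff dist_nonneg] at h2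
    rw [← dist_eq_norm]
    refine h2.trans ?_
    rw [dist_comm]
    exact (Metric.mem_ball.1 hxz).le

theorem norm_restr_mono {J : Set ℝ} {A B : Set ℝ} (h : A ⊆ B) (f : L1 J) :
    ‖restr J A f‖ ≤ ‖restr J B f‖ := by
  rw [norm_restr, norm_restr]
  exact setIntegral_mono_set (L1.integrable_coeFn _).norm.integrableOn
      (ae_of_all _ fun v => norm_nonneg _) (LE.le.eventuallyLE h)

theorem norm_restr_add_compl {J : Set ℝ} {A : Set ℝ} (h : MeasurableSet A) (f : L1 J) :
    ‖restr J A f‖ + ‖restr J Aᶜ f‖ = ‖f‖ := by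
  rw [norm_restr, norm_restr, L1.norm_eq_integral_norm]
  exact integral_add_compl h (L1.integrable_coeFn _).norm

theorem coeFn_sum {I : Set ℝ} {ι : Type*} (R : Finset ι) (p : ι → L1 I) :
    (∑ z ∈ R, p z : L1 I) =ᵐ[volume.restrict I] fun v => ∑ z ∈ R, p z v := by
  classical
  induction R using Finset.induction_on with
  | empty =>
    filter_upwards [Lp.coeFn_zero ℂ 1 (volume.restrict I)] with v hv
    simpa using hv
  | insert a R ha ih =>
    rw [Finset.sum_insert ha]
    filter_upwards [ih, Lp.coeFn_add (p a) (∑ z ∈ R, p z)] with v h1 h2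
    rw [h2, Finset.sum_insert ha, Pi.add_apply, h1]

/-- Splitting an integrable function according to its discretized phase. -/
theorem exists_phase_decomposition {I : Set ℝ} (h : L1 I) {η : ℝ} (q : SimpleFunc ℂ ℂ)
    (hq : ∀ z, ‖z‖ = 1 → ‖q z - z‖ ≤ η) :
    ∃ p : ℂ → L1 I, (∀ z, InCone (p z)) ∧
      (∀ z, p z =ᵐ[volume.restrict I] fun v => if q (phase (h v)) = z then ((‖h v‖ : ℝ) : ℂ) else 0)
      ∧ ∑ z ∈ q.range, ‖p z‖ = ‖h‖ ∧ ‖h - ∑ z ∈ q.range, z • p z‖ ≤ η * ‖h‖ := by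
  classical
  have hm : Measurable fun v => q (phase (h v)) :=
    q.measurable.comp (measurable_phase.comp (Lp.stronglyMeasurable h).measurable)
  have hE : ∀ z, MeasurableSet {v | q (phase (h v)) = z} := fun z =>
    hm (measurableSet_singleton z)
  have hL : ∀ z, MemLp (fun v => (((if q (phase (h v)) = z then ‖h v‖ else 0 : ℝ)) : ℂ)) 1
      (volume.restrict I) := fun z => by
    have h1 : MemLp (fun v => ((‖h v‖ : ℝ) : ℂ)) 1 (volume.restrict I) := (Lp.memLp h).norm.ofReal
    refine (h1.indicator (hE z)).congr_norm ?_ ?_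
    · exact (Measurable.ite (hE z) (Lp.stronglyMeasurable h).measurable.norm
        measurable_const).complex_ofReal.aestronglyMeasurable
    · refine ae_of_all _ fun v => ?_
      by_cases hv : q (phase (h v)) = z <;> simp [hv]
  have hpc : ∀ z, (hL z).toLp _ =ᵐ[volume.restrict I]
      fun v => if q (phase (h v)) = z then ((‖h v‖ : ℝ) : ℂ) else 0 := fun z => by
    filter_upwards [(hL z).coeFn_toLp] with v hv
    rw [hv]
    split_ifs <;> simp
  refine ⟨fun z => (hL z).toLp _, fun z => inCone_toLp (fun v => by positivity) (hL z), hpc, ?_, ?_⟩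
  · simp only [L1.norm_eq_integral_norm]
    rw [← integral_finsetSum _ fun z _ => (L1.integrable_coeFn _).norm]
    refine integral_congr_ae ?_
    have := (Finset.eventually_all q.range).2 fun z _ => hpc z
    filter_upwards [this] with v hv
    rw [Finset.sum_congr rfl fun z hz => by rw [hv z hz]]
    rw [Finset.sum_eq_single_of_mem (q (phase (h v))) (q.mem_range_self _)]
    · simp
    · intro z _ hz
      rw [if_neg hz.symm, norm_zero]
  · rw [L1.norm_eq_integral_norm, L1.norm_eq_integral_norm, ← integral_const_mul]
    refine integral_mono_ae (L1.integrable_coeFn _).norm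
      ((L1.integrable_coeFn _).norm.const_mul _) ?_
    have h1 := (Finset.eventually_all q.range).2 fun z _ => hpc z
    have h2 := (Finset.eventually_all q.range).2 fun z _ => Lp.coeFn_smul z ((hL z).toLp _)
    filter_upwards [h1, h2, coeFn_sum q.range fun z => z • (hL z).toLp _,
      Lp.coeFn_sub h (∑ z ∈ q.range, z • (hL z).toLp _)] with v h1 h2 h3 h4
    rw [h4, Pi.sub_apply, h3]
    rw [Finset.sum_congr rfl fun z hz => by rw [h2 z hz, Pi.smul_apply, h1 z hz]]
    rw [Finset.sum_eq_single_of_mem (q (phase (h v))) (q.mem_range_self _)]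
    · rw [if_pos rfl]
      -- Where `h` vanishes its phase is `0`, off the circle, and the approximation property of `q`
      -- says nothing.
      by_cases h0 : h v = 0
      · simp [h0]
      · have e : h v - q (phase (h v)) • ((‖h v‖ : ℝ) : ℂ)
            = (phase (h v) - q (phase (h v))) * (‖h v‖ : ℝ) := by
          rw [sub_mul, phase_mul_norm, smul_eq_mul]
        rw [e, norm_mul, Complex.norm_real, norm_norm, norm_sub_rev]
        gcongr
        exact hq _ (norm_phase h0)
    · intro z _ hz
      rw [if_neg hz.symm, smul_zero]

/-! ### Near-preservation of the norm forces phases to cluster. -/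

theorem norm_sub_sq_le {s z : ℂ} (hs : ‖s‖ ≤ 1) (hz : ‖z‖ = 1) :
    ‖s - z‖ ^ 2 ≤ 2 - 2 * ((starRingEnd ℂ) s * z).re := by
  have h1 : ‖s - z‖ ^ 2 = ‖s‖ ^ 2 + ‖z‖ ^ 2 - 2 * ((starRingEnd ℂ) s * z).re := by
    rw [← Complex.normSq_eq_norm_sq, ← Complex.normSq_eq_norm_sq, ← Complex.normSq_eq_norm_sq,
      Complex.normSq_apply, Complex.normSq_apply, Complex.normSq_apply]
    simp
    ring
  rw [h1, hz]
  nlinarith [norm_nonneg s]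

/-- If a stochastic operator nearly preserves the norm of `h`, then the phase of the image agrees
on average with the phases of the pieces of `h`. -/
theorem IsStochastic.sum_integral_phase_sub_le {I J : Set ℝ} {O : L1 I →L[ℂ] L1 J}
    (hO : IsStochastic O) (h : L1 I) (R : Finset ℂ) (hR : ∀ z ∈ R, ‖z‖ = 1) (p : ℂ → L1 I)
    (hp : ∀ z, InCone (p z)) :
    ∑ z ∈ R, ∫ v, ‖phase (O h v) - z‖ ^ 2 * ‖O (p z) v‖ ∂(volume.restrict J) ≤
      2 * (∑ z ∈ R, ‖p z‖ - ‖O h‖ + ‖h - ∑ z ∈ R, z • p z‖) := by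
  have hint : ∀ z ∈ R, Integrable (fun v => ‖phase (O h v) - z‖ ^ 2 * ‖O (p z) v‖)
      (volume.restrict J) := fun z hz => by
    refine (L1.integrable_coeFn (O (p z))).norm.bdd_mul (c := 4) ?_ (ae_of_all _ fun v => ?_)
    · exact (((measurable_phase.comp (Lp.stronglyMeasurable (O h)).measurable).sub_const
        z).norm.pow_const 2).aestronglyMeasurable
    · rw [Real.norm_of_nonneg (by positivity)]
      have := norm_sub_le (phase (O h v)) z
      have h1 := norm_phase_le (O h v)
      rw [hR z hz] at this
      nlinarith [norm_nonneg (phase (O h v) - z)]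
  rw [← integral_finsetSum _ hint]
  set k := ∑ z ∈ R, z • p z with hk
  have hOk : O k = ∑ z ∈ R, z • O (p z) := by simp [hk]
  have hb : Integrable (fun v => 2 * (∑ z ∈ R, ‖O (p z) v‖ - ‖O h v‖ + ‖O (h - k) v‖))
      (volume.restrict J) :=
    (((integrable_finsetSum _ fun z _ => (L1.integrable_coeFn (O (p z))).norm).sub
      (L1.integrable_coeFn _).norm).add (L1.integrable_coeFn _).norm).const_mul 2
  calc _ ≤ ∫ v, 2 * (∑ z ∈ R, ‖O (p z) v‖ - ‖O h v‖ + ‖O (h - k) v‖) ∂(volume.restrict J) := by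
        refine integral_mono_ae (integrable_finsetSum _ hint) hb ?_
        have h1 := (Finset.eventually_all R).2 fun z _ => Lp.coeFn_smul z (O (p z))
        have h2 := (Finset.eventually_all R).2 fun z _ => ((hO _ (hp z)).1).coeFn_eq
        have h3 := coeFn_sum R fun z => z • O (p z)
        rw [← hOk] at h3
        have h4 := Lp.coeFn_sub (O h) (O k)
        rw [← map_sub] at h4
        filter_upwards [h1, h2, h3, h4] with v h1 h2 h3 h4
        set s := phase (O h v) with hs
        have hsle : ‖s‖ ≤ 1 := norm_phase_le _
        -- Pairing with the conjugate phase `s` of `O h` recovers `‖O h‖`, and weights each positive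
        -- piece `O (p z)` by the cosine between `s` and `z`. The defect in the triangle inequality
        -- thus controls the squared phase deviations.
        have e1 : ((starRingEnd ℂ) s * O k v).re
            = ∑ z ∈ R, ((starRingEnd ℂ) s * z).re * ‖O (p z) v‖ := by
          rw [h3, Finset.mul_sum, Complex.re_sum]
          refine Finset.sum_congr rfl fun z hz => ?_
          rw [h1 z hz, Pi.smul_apply, h2 z hz, smul_eq_mul, ← mul_assoc, Complex.re_mul_ofReal]
          simp
        have e2 : ((starRingEnd ℂ) s * O h v).re = ‖O h v‖ := by
          rw [hs, conj_phase_mul, Complex.ofReal_re]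
        have e3 : ((starRingEnd ℂ) s * O (h - k) v).re ≤ ‖O (h - k) v‖ := by
          refine (Complex.re_le_norm _).trans ?_
          rw [norm_mul, Complex.norm_conj]
          exact mul_le_of_le_one_left (norm_nonneg _) hsle
        rw [h4, Pi.sub_apply, mul_sub, Complex.sub_re, e1, e2] at e3
        rw [h4, Pi.sub_apply]
        calc ∑ z ∈ R, ‖s - z‖ ^ 2 * ‖O (p z) v‖
            ≤ ∑ z ∈ R, (2 - 2 * ((starRingEnd ℂ) s * z).re) * ‖O (p z) v‖ := by
              gcongr with z hz
              exact norm_sub_sq_le hsle (hR z hz)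
          _ = 2 * (∑ z ∈ R, ‖O (p z) v‖)
              - 2 * ∑ z ∈ R, ((starRingEnd ℂ) s * z).re * ‖O (p z) v‖ := by
              rw [Finset.mul_sum, Finset.mul_sum, ← Finset.sum_sub_distrib]
              exact Finset.sum_congr rfl fun z _ => by ring
          _ ≤ _ := by linarith
    _ = 2 * (∑ z ∈ R, ‖O (p z)‖ - ‖O h‖ + ‖O (h - k)‖) := by
        rw [integral_const_mul, integral_add, integral_sub, integral_finsetSum]
        · simp only [L1.norm_eq_integral_norm]
        · exact fun z _ => (L1.integrable_coeFn _).norm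
        · exact integrable_finsetSum _ fun z _ => (L1.integrable_coeFn (O (p z))).norm
        · exact (L1.integrable_coeFn _).norm
        · exact (integrable_finsetSum _ fun z _ => (L1.integrable_coeFn (O (p z))).norm).sub
            (L1.integrable_coeFn _).norm
        · exact (L1.integrable_coeFn _).norm
    _ ≤ _ := by
        rw [Finset.sum_congr rfl fun z _ => (hO _ (hp z)).2]
        have := hO.norm_le (h - k)
        linarith

/-- A subfamily of sets which is maximal for pairwise disjointness. -/
theorem exists_maximal_pairwiseDisjoint {α ι : Type*} (R : Finset ι) (S : ι → Set α) :
    ∃ Z ⊆ R, (Z : Set ι).PairwiseDisjoint S ∧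
      ∀ z ∈ R, (S z).Nonempty → ∃ z' ∈ Z, (S z ∩ S z').Nonempty := by
  classical
  obtain ⟨Z, hZ, hmax⟩ := Finset.exists_max_image
    (R.powerset.filter fun Z : Finset ι => (Z : Set ι).PairwiseDisjoint S) Finset.card
    ⟨∅, by simp⟩
  simp only [Finset.mem_filter, Finset.mem_powerset] at hZ hmax
  refine ⟨Z, hZ.1, hZ.2, fun z hz hne => ?_⟩
  by_contra! H
  by_cases hzZ : z ∈ Z
  · have := H z hzZ
    rw [inter_self] at this
    exact hne.ne_empty this
  · have h1 := hmax (insert z Z) ⟨Finset.insert_subset hz hZ.1, by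
      rw [Finset.coe_insert]
      exact hZ.2.insert fun j hj _ => disjoint_iff_inter_eq_empty.2 (H j hj)⟩
    rw [Finset.card_insert_of_notMem hzZ] at h1
    omega

/-- The set of points where the phase of `f` is at distance at least `r` from every point
of `Z`. -/
def farSet {I : Set ℝ} (f : L1 I) (Z : Finset ℂ) (r : ℝ) : Set ℝ :=
  {v | ∀ z ∈ Z, r ≤ ‖phase (f v) - z‖}

theorem measurable_phase_coeFn {I : Set ℝ} (f : L1 I) : Measurable fun v => phase (f v) :=
  measurable_phase.comp (Lp.stronglyMeasurable f).measurable

theorem measurableSet_farSet {I : Set ℝ} (f : L1 I) (Z : Finset ℂ) (r : ℝ) :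
    MeasurableSet (farSet f Z r) := by
  have : farSet f Z r = ⋂ z ∈ Z, {v | r ≤ ‖phase (f v) - z‖} := by
    ext v
    simp [farSet]
  rw [this]
  exact Z.measurableSet_biInter fun z _ =>
    measurableSet_le measurable_const ((measurable_phase_coeFn f).sub_const z).norm

/-- Chebyshev's inequality for the phase deviation. -/
theorem sq_mul_norm_restr_le {J : Set ℝ} (f g : L1 J) {z : ℂ} (hz : ‖z‖ = 1) {r : ℝ}
    (hr : 0 ≤ r) :
    r ^ 2 * ‖restr J {v | r ≤ ‖phase (f v) - z‖} g‖ ≤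
      ∫ v, ‖phase (f v) - z‖ ^ 2 * ‖g v‖ ∂(volume.restrict J) := by
  have hm : Measurable fun v => ‖phase (f v) - z‖ := ((measurable_phase_coeFn f).sub_const z).norm
  have hi : Integrable (fun v => ‖phase (f v) - z‖ ^ 2 * ‖g v‖) (volume.restrict J) := by
    refine (L1.integrable_coeFn g).norm.bdd_mul (c := 4) (hm.pow_const 2).aestronglyMeasurable
      (ae_of_all _ fun v => ?_)
    rw [Real.norm_of_nonneg (by positivity)]
    have := norm_sub_le (phase (f v)) z
    have h1 := norm_phase_le (f v)
    rw [hz] at this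
    nlinarith [norm_nonneg (phase (f v) - z)]
  rw [norm_restr, ← integral_const_mul]
  calc _ ≤ ∫ v in {v | r ≤ ‖phase (f v) - z‖}, ‖phase (f v) - z‖ ^ 2 * ‖g v‖
        ∂(volume.restrict J) := by
        refine setIntegral_mono_on ((L1.integrable_coeFn g).norm.const_mul _).integrableOn
          hi.integrableOn (measurableSet_le measurable_const hm) fun v hv => ?_
        have : r ≤ ‖phase (f v) - z‖ := hv
        gcongr
    _ ≤ _ := setIntegral_le_integral hi (ae_of_all _ fun v => by positivity)

/-- If a spreading stochastic operator nearly preserves the norm of `h`, then the phases of `h` and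
of its image both cluster at boundedly many points of the unit circle. -/
theorem IsSpreading.exists_cluster {I J : Set ℝ} [IsFiniteMeasure (volume.restrict J)]
    {O : L1 I →L[ℂ] L1 J} (hO : IsStochastic O) (hs : IsSpreading O) :
    ∃ C : ℕ, ∀ r > 0, ∀ ε > 0, ∃ δ > 0, ∀ h : L1 I, ‖h‖ ≤ 1 → 1 - δ ≤ ‖O h‖ →
      ∃ Z : Finset ℂ, Z.card ≤ C ∧ (∀ z ∈ Z, ‖z‖ = 1) ∧
        ‖restr I (farSet h Z r) h‖ ≤ ε ∧ ‖restr J (farSet (O h) Z r) (O h)‖ ≤ ε := by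
  classical
  obtain ⟨δ₀, hδ₀, θ, hθ, H⟩ := hs
  -- `C` counts disjoint sets of measure at least `δ₀` in `J`. It must not depend on `r` or `ε`,
  -- since the radius is later chosen in terms of it.
  obtain ⟨C, hC⟩ := ENNReal.exists_nat_gt (r := volume.restrict J univ / δ₀)
    (ENNReal.div_ne_top (measure_ne_top _ _) hδ₀.ne')
  refine ⟨C, fun r₀ hr₀ ε hε => ?_⟩
  -- Distance budget: at most `r` for discretizing the phase and `2r` for passing to a selected
  -- centre, which stays below `4r`.
  obtain ⟨r, hr, rfl⟩ : ∃ r > 0, r₀ = 4 * r := ⟨r₀ / 4, by positivity, by ring⟩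
  have hθ' : 0 < 1 - θ := by linarith
  -- Chosen so that `η * c` is the total error `η + τ / (1 - θ) + τ`.
  set c : ℝ := 1 + 4 / r ^ 2 * (1 / (1 - θ) + 1) with hc
  have hc0 : 0 < c := by positivity
  obtain ⟨η, hη0, hηr, hηε⟩ : ∃ η > 0, η ≤ r ∧ η * c ≤ ε :=
    ⟨min r (ε / c), by positivity, min_le_left _ _, by
      calc min r (ε / c) * c ≤ ε / c * c := by gcongr; exact min_le_right _ _
        _ = ε := by field_simp⟩
  refine ⟨η, hη0, fun h hh hOh => ?_⟩
  obtain ⟨q, hq1, hq⟩ := exists_simpleFunc_circle hη0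
  obtain ⟨p, hp, hpv, hpsum, hk⟩ := exists_phase_decomposition h q hq
  set R := q.range with hRdef
  have hR : ∀ z ∈ R, ‖z‖ = 1 := fun z hz => by
    obtain ⟨x, rfl⟩ := SimpleFunc.mem_range.1 hz
    exact hq1 x
  have hkη : ‖h - ∑ z ∈ R, z • p z‖ ≤ η :=
    hk.trans (mul_le_of_le_one_right hη0.le hh)
  set A : ℂ → Set ℝ := fun z => {v | r ≤ ‖phase (O h v) - z‖} with hA
  have hAm : ∀ z, MeasurableSet (A z) := fun z =>
    measurableSet_le measurable_const ((measurable_phase_coeFn (O h)).sub_const z).norm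
  set d : ℂ → ℝ := fun z => ‖restr J (A z) (O (p z))‖ with hd
  -- Chebyshev: the norm defect and the discretization error are each at most `η`, giving total
  -- deviation at most `4η`.
  set τ : ℝ := 4 * η / r ^ 2 with hτ
  have hdsum : ∑ z ∈ R, d z ≤ τ := by
    rw [hτ, le_div_iff₀ (by positivity), mul_comm, Finset.mul_sum]
    calc _ ≤ ∑ z ∈ R, ∫ v, ‖phase (O h v) - z‖ ^ 2 * ‖O (p z) v‖ ∂(volume.restrict J) :=
          Finset.sum_le_sum fun z hz => sq_mul_norm_restr_le (O h) (O (p z)) (hR z hz) hr.le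
      _ ≤ _ := hO.sum_integral_phase_sub_le h R hR p hp
      _ ≤ _ := by
        rw [hpsum]
        linarith
  set small := R.filter fun z => volume.restrict J (A z)ᶜ < δ₀ with hsmall
  set big := R.filter fun z => ¬ volume.restrict J (A z)ᶜ < δ₀ with hbig
  -- If the set where the output phase is near `z` is small, spreading pushes a share `1 - θ` of `O
  -- (p z)` outside it, where the total mass is at most `τ`.
  have hsm : ∑ z ∈ small, ‖p z‖ ≤ τ / (1 - θ) := by
    rw [le_div_iff₀ hθ', Finset.sum_mul]
    calc _ ≤ ∑ z ∈ small, d z := by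
          refine Finset.sum_le_sum fun z hz => ?_
          have h1 := norm_restr_add_compl (hAm z) (O (p z))
          have h2 := H _ (hAm z).compl (Finset.mem_filter.1 hz).2 (p z)
          rw [(hO _ (hp z)).2] at h1
          have h3 : d z = ‖restr J (A z) (O (p z))‖ := rfl
          linarith
      _ ≤ ∑ z ∈ R, d z := Finset.sum_le_sum_of_subset_of_nonneg (Finset.filter_subset _ _)
          fun z _ _ => norm_nonneg _
      _ ≤ τ := hdsum
  have hbne : ∀ z ∈ big, ((A z)ᶜ).Nonempty := fun z hz => by
    by_contra h0
    rw [not_nonempty_iff_eq_empty] at h0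
    have h1 := (Finset.mem_filter.1 hz).2
    rw [h0, measure_empty] at h1
    exact h1 hδ₀
  -- Disjoint near-sets of measure at least `δ₀` bound the number of centres; by maximality any
  -- other big `z` shares a point with a selected one, hence is within `2r` of it.
  obtain ⟨Z, hZb, hZd, hZ⟩ := exists_maximal_pairwiseDisjoint big fun z => (A z)ᶜ
  have hnear : ∀ z ∈ big, ∃ z' ∈ Z, ‖z - z'‖ < 2 * r := fun z hz => by
    obtain ⟨z', hz', v, hv1, hv2⟩ := hZ z hz (hbne z hz)
    refine ⟨z', hz', ?_⟩
    have h1 : ‖phase (O h v) - z‖ < r := not_le.1 hv1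
    have h2 : ‖phase (O h v) - z'‖ < r := not_le.1 hv2
    have h3 := norm_sub_le_norm_sub_add_norm_sub z (phase (O h v)) z'
    rw [norm_sub_rev z (phase (O h v))] at h3
    linarith
  have hτ0 : 0 ≤ τ := by positivity
  have hfin : η + τ / (1 - θ) + τ ≤ ε := by
    refine le_trans (le_of_eq ?_) hηε
    rw [hc, hτ]
    ring
  refine ⟨Z, ?_, fun z hz => hR z (Finset.mem_filter.1 (hZb hz)).1, ?_, ?_⟩
  · have h1 : (Z.card : ℝ≥0∞) * δ₀ ≤ volume.restrict J univ := by
      calc (Z.card : ℝ≥0∞) * δ₀ = ∑ z ∈ Z, δ₀ := by simp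
        _ ≤ ∑ z ∈ Z, volume.restrict J (A z)ᶜ :=
          Finset.sum_le_sum fun z hz => not_lt.1 (Finset.mem_filter.1 (hZb hz)).2
        _ = volume.restrict J (⋃ z ∈ Z, (A z)ᶜ) :=
          (measure_biUnion_finset hZd fun z _ => (hAm z).compl).symm
        _ ≤ _ := measure_mono (subset_univ _)
    have h2 : (Z.card : ℝ≥0∞) < C := lt_of_le_of_lt
      ((ENNReal.le_div_iff_mul_le (Or.inl hδ₀.ne') (Or.inr (measure_ne_top _ _))).2 h1) hC
    exact_mod_cast h2.le
  · have hle : ‖restr I (farSet h Z (4 * r)) h‖ ≤ ∑ z ∈ small, ‖p z‖ := by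
      simp only [L1.norm_eq_integral_norm (p _)]
      rw [← integral_finsetSum _ fun z _ => (L1.integrable_coeFn _).norm, norm_restr,
        ← integral_indicator (measurableSet_farSet _ _ _)]
      refine integral_mono_ae
        ((L1.integrable_coeFn _).norm.indicator (measurableSet_farSet _ _ _))
        (integrable_finsetSum _ fun z _ => (L1.integrable_coeFn (p z)).norm) ?_
      filter_upwards [(Finset.eventually_all R).2 fun z _ => hpv z] with v hv
      have hnn : ∀ z ∈ small, 0 ≤ ‖p z v‖ := fun z _ => norm_nonneg _
      by_cases hvf : v ∈ farSet h Z (4 * r)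
      swap
      · rw [indicator_of_notMem hvf]
        exact Finset.sum_nonneg hnn
      rw [indicator_of_mem hvf]
      by_cases h0 : h v = 0
      · rw [h0, norm_zero]
        exact Finset.sum_nonneg hnn
      have hzR : q (phase (h v)) ∈ R := q.mem_range_self _
      have hzs : q (phase (h v)) ∈ small := by
        by_contra hzs
        have hzb : q (phase (h v)) ∈ big := Finset.mem_filter.2
          ⟨hzR, fun h1 => hzs (Finset.mem_filter.2 ⟨hzR, h1⟩)⟩
        obtain ⟨z', hz', hlt⟩ := hnear _ hzb
        have h1 := hvf z' hz'
        have h2 := hq _ (norm_phase h0)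
        have h3 := norm_sub_le_norm_sub_add_norm_sub (phase (h v)) (q (phase (h v))) z'
        rw [norm_sub_rev] at h2
        linarith
      refine le_trans (le_of_eq ?_) (Finset.single_le_sum hnn hzs)
      rw [hv _ hzR, if_pos rfl, Complex.norm_real, norm_norm]
    linarith
  · set F := farSet (O h) Z (4 * r) with hF
    have h1 : ‖restr J F (O h)‖ ≤ η + ∑ z ∈ R, ‖restr J F (O (p z))‖ := by
      have e : restr J F (O h) = restr J F (O (h - ∑ z ∈ R, z • p z))
          + ∑ z ∈ R, z • restr J F (O (p z)) := by
        simp [map_sub, map_sum]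
      rw [e]
      refine (norm_add_le _ _).trans (add_le_add
        ((norm_restr_le _ _).trans ((hO.norm_le _).trans hkη)) ?_)
      refine (norm_sum_le _ _).trans (Finset.sum_le_sum fun z hz => ?_)
      rw [norm_smul, hR z hz, one_mul]
    have h2 : ∑ z ∈ R, ‖restr J F (O (p z))‖ ≤ ∑ z ∈ small, ‖p z‖ + ∑ z ∈ R, d z := by
      rw [← Finset.sum_filter_add_sum_filter_not R fun z => volume.restrict J (A z)ᶜ < δ₀]
      refine add_le_add (Finset.sum_le_sum fun z _ => (norm_restr_le _ _).trans (hO.norm_le _)) ?_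
      refine (Finset.sum_le_sum fun z hz => ?_).trans (Finset.sum_le_sum_of_subset_of_nonneg
        (Finset.filter_subset _ _) fun z _ _ => norm_nonneg _)
      refine norm_restr_mono (fun v hv => ?_) _
      obtain ⟨z', hz', hlt⟩ := hnear z hz
      have h1 : 4 * r ≤ ‖phase (O h v) - z'‖ := hv z' hz'
      have h3 := norm_sub_le_norm_sub_add_norm_sub (phase (O h v)) z z'
      change r ≤ ‖phase (O h v) - z‖
      linarith
    linarith

/-! ### Strict contraction from a multiplier with null level sets. -/

/-- A bounded measurable function with null level sets takes values in small discs only on sets of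
small measure. -/
theorem exists_measure_preimage_ball_lt {α : Type*} [MeasurableSpace α] (μ : Measure α)
    [IsFiniteMeasure μ] {n : α → ℂ} (hn : Measurable n) (h0 : ∀ ζ, μ (n ⁻¹' {ζ}) = 0)
    {ε : ℝ≥0∞} (hε : 0 < ε) :
    ∃ ρ > 0, ∀ ζ : ℂ, ‖ζ‖ ≤ 1 → μ (n ⁻¹' Metric.ball ζ ρ) < ε := by
  have h1 : ∀ ζ : ℂ, ∃ ρ > 0, μ (n ⁻¹' Metric.ball ζ ρ) < ε := fun ζ => by
    have ht : Tendsto (fun k : ℕ => μ (n ⁻¹' Metric.ball ζ (1 / (k + 1)))) atTop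
        (𝓝 (μ (⋂ k : ℕ, n ⁻¹' Metric.ball ζ (1 / (k + 1))))) := by
      refine tendsto_measure_iInter_atTop
        (fun k => (hn measurableSet_ball).nullMeasurableSet) ?_ ⟨0, measure_ne_top _ _⟩
      intro k l hkl
      refine preimage_mono (Metric.ball_subset_ball ?_)
      exact Nat.one_div_le_one_div hkl
    have he : (⋂ k : ℕ, n ⁻¹' Metric.ball ζ (1 / (k + 1))) = n ⁻¹' {ζ} := by
      rw [← preimage_iInter]
      congr 1
      ext z
      simp only [mem_iInter, Metric.mem_ball, mem_singleton_iff]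
      constructor
      · intro h
        by_contra hne
        obtain ⟨k, hk⟩ := exists_nat_one_div_lt (dist_pos.2 hne)
        exact absurd (h k) (not_lt.2 hk.le)
      · rintro rfl k
        rw [dist_self]
        positivity
    rw [he, h0] at ht
    obtain ⟨k, hk⟩ := (ht.eventually_lt_const hε).exists
    exact ⟨1 / (k + 1), by positivity, hk⟩
  choose ρ hρ0 hρ using h1
  -- A Lebesgue number turns the centre-dependent radii into a uniform one.
  obtain ⟨δ, hδ, hδ'⟩ := lebesgue_number_lemma_of_metric (isCompact_closedBall (0 : ℂ) 1)
    (c := fun ζ => Metric.ball ζ (ρ ζ)) (fun _ => Metric.isOpen_ball)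
    fun ζ _ => mem_iUnion.2 ⟨ζ, Metric.mem_ball_self (hρ0 ζ)⟩
  refine ⟨δ, hδ, fun ζ hζ => ?_⟩
  obtain ⟨i, hi⟩ := hδ' ζ (by simpa using hζ)
  exact (measure_mono (preimage_mono hi)).trans_lt (hρ i)

/-- Two spreading stochastic operators separated by multiplication by a unimodular function with
null level sets have a composition of norm less than one. -/
theorem norm_comp_mul_comp_lt_one {I J L : Set ℝ} [IsFiniteMeasure (volume.restrict J)]
    [IsFiniteMeasure (volume.restrict L)]
    {O : L1 J →L[ℂ] L1 L} {O' : L1 I →L[ℂ] L1 J} (hO : IsStochastic O) (hs : IsSpreading O)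
    (hO' : IsStochastic O') (hs' : IsSpreading O') {n : ℝ → ℂ} (hn : Measurable n)
    (hn1 : ∀ v, ‖n v‖ = 1) (h0 : ∀ ζ, volume.restrict J (n ⁻¹' {ζ}) = 0) (N : L1 J →L[ℂ] L1 J)
    (hN : ∀ u : L1 J, N u =ᵐ[volume.restrict J] fun v => n v * u v) :
    ‖O.comp (N.comp O')‖ < 1 := by
  classical
  obtain ⟨C, hC⟩ := hs.exists_cluster hO
  obtain ⟨C', hC'⟩ := hs'.exists_cluster hO'
  obtain ⟨δ', hδ', θ', hθ', H'⟩ := hs'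
  obtain ⟨δ₀, hδ₀, hδt, θ, hθ0, hθ, H⟩ : ∃ δ₀ : ℝ≥0∞, 0 < δ₀ ∧ δ₀ ≠ ∞ ∧ ∃ θ : ℝ, 0 ≤ θ ∧ θ < 1 ∧
      ∀ B, MeasurableSet B → volume.restrict J B < δ₀ →
        ∀ f, ‖f‖ ≤ 1 → ‖restr J B (O' f)‖ ≤ θ := by
    refine ⟨min δ' 1, lt_min hδ' one_pos, ne_top_of_le_ne_top ENNReal.one_ne_top
      (min_le_right _ _), max θ' 0, le_max_right _ _, by simp [hθ'], fun B hB hBδ f hf => ?_⟩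
    calc _ ≤ θ' * ‖f‖ := H' B hB (hBδ.trans_le (min_le_left _ _)) f
      _ ≤ max θ' 0 * ‖f‖ := by gcongr; exact le_max_left _ _
      _ ≤ max θ' 0 := mul_le_of_le_one_right (le_max_right _ _) hf
  -- There are at most `C * C'` quotients of cluster points; the `+ 1` gives a strict inequality and
  -- a nonzero denominator.
  have hD : (0 : ℝ≥0∞) < δ₀ / (C * C' + 1 : ℕ) :=
    ENNReal.div_pos hδ₀.ne' (ENNReal.natCast_ne_top _)
  obtain ⟨ρ, hρ, hball⟩ := exists_measure_preimage_ball_lt (volume.restrict J) hn h0 hD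
  -- In the end `‖u‖ ≤ θ + 2ε = 1 - 2ε`, against `‖u‖ > 1 - κ ≥ 1 - ε`.
  set ε : ℝ := (1 - θ) / 4 with hε_def
  have hε : 0 < ε := by linarith
  obtain ⟨δ₁, hδ₁, h1⟩ := hC (ρ / 2) (by positivity) ε hε
  obtain ⟨δ₂, hδ₂, h2⟩ := hC' (ρ / 2) (by positivity) ε hε
  have hNn : ∀ u, ‖N u‖ = ‖u‖ := fun u => by
    rw [L1.norm_eq_integral_norm, L1.norm_eq_integral_norm]
    refine integral_congr_ae ?_
    filter_upwards [hN u] with v hv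
    rw [hv, norm_mul, hn1, one_mul]
  obtain ⟨κ, hκ0, hκ1, hκ2, hκ3⟩ : ∃ κ > 0, κ ≤ δ₁ ∧ κ ≤ δ₂ ∧ κ ≤ ε :=
    ⟨min δ₁ (min δ₂ ε), by positivity, min_le_left _ _,
      (min_le_right _ _).trans (min_le_left _ _), (min_le_right _ _).trans (min_le_right _ _)⟩
  suffices hmain : ∀ f : L1 I, ‖f‖ ≤ 1 → ‖O (N (O' f))‖ ≤ 1 - κ by
    refine (ContinuousLinearMap.opNorm_le_bound _ (M := 1 - κ) (by linarith) fun f => ?_).trans_lt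
      (by linarith)
    change ‖O (N (O' f))‖ ≤ _
    by_cases hf : f = 0
    · simp [hf]
    have hf0 : 0 < ‖f‖ := norm_pos_iff.2 hf
    have h3 := hmain (((‖f‖⁻¹ : ℝ) : ℂ) • f) (by
      rw [norm_smul, Complex.norm_real, norm_inv, norm_norm, inv_mul_cancel₀ hf0.ne'])
    rw [map_smul, map_smul, map_smul, norm_smul, Complex.norm_real, norm_inv, norm_norm,
      inv_mul_eq_div, div_le_iff₀ hf0] at h3
    exact h3
  intro f hf
  by_contra! hbig
  set u := O' f with hu
  have hOu : ‖O (N u)‖ ≤ ‖u‖ := (hO.norm_le _).trans (hNn u).le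
  have hu1 : ‖u‖ ≤ 1 := (hO'.norm_le f).trans hf
  obtain ⟨Z, hZc, hZ1, hZ, -⟩ := h1 (N u) ((hNn u).trans_le hu1) (by linarith)
  obtain ⟨Z', hZc', hZ1', -, hZ'⟩ := h2 f hf (by linarith)
  set F := farSet (N u) Z (ρ / 2) with hF
  set F' := farSet u Z' (ρ / 2) with hF'
  set A : Set ℝ := ⋃ x ∈ Z ×ˢ Z', n ⁻¹' Metric.ball (x.1 * (starRingEnd ℂ) x.2) ρ with hA
  have hAm : MeasurableSet A := Finset.measurableSet_biUnion _ fun x _ => hn measurableSet_ball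
  have hAδ : volume.restrict J A < δ₀ := by
    calc volume.restrict J A
        ≤ ∑ x ∈ Z ×ˢ Z', volume.restrict J (n ⁻¹' Metric.ball (x.1 * (starRingEnd ℂ) x.2) ρ) :=
          measure_biUnion_finset_le _ _
      _ ≤ ∑ x ∈ Z ×ˢ Z', δ₀ / (C * C' + 1 : ℕ) := by
          refine Finset.sum_le_sum fun x hx => (hball _ ?_).le
          rw [Finset.mem_product] at hx
          rw [norm_mul, Complex.norm_conj, hZ1 _ hx.1, hZ1' _ hx.2, one_mul]
      _ = ((Z.card * Z'.card : ℕ) : ℝ≥0∞) * (δ₀ / (C * C' + 1 : ℕ)) := by simp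
      _ < (C * C' + 1 : ℕ) * (δ₀ / (C * C' + 1 : ℕ)) := by
          refine ENNReal.mul_lt_mul_left hD.ne' (ENNReal.div_ne_top hδt (by positivity)) ?_
          exact_mod_cast Nat.lt_succ_of_le (Nat.mul_le_mul hZc hZc')
      _ = δ₀ := ENNReal.mul_div_cancel (by positivity) (ENNReal.natCast_ne_top _)
  have hFu : ‖restr J F u‖ ≤ ε := by
    refine le_trans (le_of_eq ?_) hZ
    rw [norm_restr, norm_restr]
    refine integral_congr_ae (ae_restrict_of_ae ?_)
    filter_upwards [hN u] with v hv
    rw [hv, norm_mul, hn1, one_mul]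
  have hle : ‖u‖ ≤ ‖restr J A u‖ + ‖restr J F u‖ + ‖restr J F' u‖ := by
    have hFm : MeasurableSet F := measurableSet_farSet _ _ _
    have hFm' : MeasurableSet F' := measurableSet_farSet _ _ _
    have hi := (L1.integrable_coeFn u).norm
    have hi2 : Integrable (fun v => A.indicator (fun a => ‖u a‖) v + F.indicator (fun a => ‖u a‖) v)
        (volume.restrict J) := (hi.indicator hAm).add (hi.indicator hFm)
    rw [norm_restr, norm_restr, norm_restr, L1.norm_eq_integral_norm, ← integral_indicator hAm,
      ← integral_indicator hFm, ← integral_indicator hFm', ← integral_add (hi.indicator hAm)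
      (hi.indicator hFm), ← integral_add hi2 (hi.indicator hFm')]
    refine integral_mono_ae hi (hi2.add (hi.indicator hFm')) ?_
    filter_upwards [hN u] with v hv
    have hnn : ∀ B : Set ℝ, 0 ≤ B.indicator (fun a => ‖u a‖) v := fun B =>
      indicator_nonneg (fun _ _ => norm_nonneg _) _
    have hA0 := hnn A
    have hF0 := hnn F
    have hF0' := hnn F'
    by_cases hvF : v ∈ F
    · rw [indicator_of_mem hvF]
      linarith
    by_cases hvF' : v ∈ F'
    · rw [indicator_of_mem hvF']
      linarith
    -- Outside both far sets, `n * phase u` is within `ρ / 2` of some `z` and `phase u` within `ρ /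
    -- 2` of some `z'`, so `n` is within `ρ` of `z * conj z'`.
    have hvA : v ∈ A := by
      simp only [hF, hF', farSet, mem_ofPred_eq, not_forall, not_le, hv, phase_mul (hn1 v)]
        at hvF hvF'
      obtain ⟨z, hz, hlt⟩ := hvF
      obtain ⟨z', hz', hlt'⟩ := hvF'
      refine mem_iUnion₂.2 ⟨(z, z'), Finset.mk_mem_product hz hz', ?_⟩
      rw [mem_preimage, Metric.mem_ball, dist_eq_norm]
      have hc : z' * (starRingEnd ℂ) z' = 1 := by simp [Complex.mul_conj', hZ1' z' hz']
      have e1 : ‖n v - z * (starRingEnd ℂ) z'‖ = ‖n v * z' - z‖ := by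
        have e : n v - z * (starRingEnd ℂ) z' = (n v * z' - z) * (starRingEnd ℂ) z' := by
          rw [sub_mul, mul_assoc, hc, mul_one]
        rw [e, norm_mul, Complex.norm_conj, hZ1' z' hz', mul_one]
      have e2 : ‖n v * z' - n v * phase (u v)‖ = ‖phase (u v) - z'‖ := by
        rw [← mul_sub, norm_mul, hn1, one_mul, norm_sub_rev]
      have := norm_sub_le_norm_sub_add_norm_sub (n v * z') (n v * phase (u v)) z
      rw [e1]
      linarith
    rw [indicator_of_mem hvA]
    linarith
  have := H A hAm hAδ f hf
  linarith

/-! ### The reflections and the multiplier. -/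

theorem coeFn_R₁ (f : L1 negI) : R₁ f =ᵐ[volume.restrict posI] fun v => f (-v) :=
  Lp.coeFn_compMeasurePreserving f measurePreserving_neg_pos_neg

theorem coeFn_R₂ (f : L1 posI) : R₂ f =ᵐ[volume.restrict negI] fun v => f (-v) :=
  Lp.coeFn_compMeasurePreserving f measurePreserving_neg_neg_pos

theorem isStochastic_R₁ : IsStochastic R₁ := fun f hf => by
  refine ⟨?_, LinearIsometry.norm_map _ f⟩
  filter_upwards [coeFn_R₁ f, measurePreserving_neg_pos_neg.quasiMeasurePreserving.ae hf]
    with v h1 h2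
  rw [h1]
  exact h2

theorem isStochastic_R₂ : IsStochastic R₂ := fun f hf => by
  refine ⟨?_, LinearIsometry.norm_map _ f⟩
  filter_upwards [coeFn_R₂ f, measurePreserving_neg_neg_pos.quasiMeasurePreserving.ae hf]
    with v h1 h2
  rw [h1]
  exact h2

theorem decay_neg (a : ℝ) (lam : ℂ) (v : ℝ) : decay a lam (-v) = decay a lam v := by
  simp [decay]

/-- The multiplier is even in `v`. This lets the two multipliers around a reflection merge inside
`G²`. -/
theorem decayMul_R₁ {a : ℝ} (ha : 0 < a) {lam : ℂ} (hlam : 0 ≤ lam.re) (f : L1 negI) :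
    decayMul ha hlam posI (R₁ f) = R₁ (decayMul ha hlam negI f) := by
  apply Lp.ext
  filter_upwards [coeFn_decayMul ha hlam posI (R₁ f), coeFn_R₁ f,
    coeFn_R₁ (decayMul ha hlam negI f),
    measurePreserving_neg_pos_neg.quasiMeasurePreserving.ae (coeFn_decayMul ha hlam negI f)]
    with v h1 h2 h3 h4
  rw [h1, h2, h3, h4, decay_neg]

theorem decayMul_R₂ {a : ℝ} (ha : 0 < a) {lam : ℂ} (hlam : 0 ≤ lam.re) (f : L1 posI) :
    decayMul ha hlam negI (R₂ f) = R₂ (decayMul ha hlam posI f) := by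
  apply Lp.ext
  filter_upwards [coeFn_decayMul ha hlam negI (R₂ f), coeFn_R₂ f,
    coeFn_R₂ (decayMul ha hlam posI f),
    measurePreserving_neg_neg_pos.quasiMeasurePreserving.ae (coeFn_decayMul ha hlam posI f)]
    with v h1 h2 h3 h4
  rw [h1, h2, h3, h4, decay_neg]

theorem norm_decay (a : ℝ) (lam : ℂ) (v : ℝ) :
    ‖decay a lam v‖ = Real.exp (-(2 * lam.re * a / |v|)) := by
  have h : (2 * lam * a / ((|v| : ℝ) : ℂ)).re = 2 * lam.re * a / |v| := by
    rw [Complex.div_ofReal_re]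
    simp
  rw [decay, Complex.norm_exp, Complex.neg_re, h]

theorem norm_decayMul_le_of_bound {a : ℝ} (ha : 0 < a) {lam : ℂ} (hlam : 0 ≤ lam.re) {I : Set ℝ}
    {c : ℝ} (hc0 : 0 ≤ c) (hc : ∀ᵐ v ∂(volume.restrict I), ‖decay a lam v‖ ≤ c) :
    ‖decayMul ha hlam I‖ ≤ c := by
  refine ContinuousLinearMap.opNorm_le_bound _ hc0 fun f => ?_
  rw [L1.norm_eq_integral_norm, L1.norm_eq_integral_norm, ← integral_const_mul]
  refine integral_mono_ae (L1.integrable_coeFn _).norm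
    ((L1.integrable_coeFn f).norm.const_mul _) ?_
  filter_upwards [hc, coeFn_decayMul ha hlam I f] with v h1 h2
  rw [h2, norm_mul]
  gcongr

theorem norm_decayMul_le {a : ℝ} (ha : 0 < a) {lam : ℂ} (hlam : 0 ≤ lam.re) (I : Set ℝ) :
    ‖decayMul ha hlam I‖ ≤ 1 :=
  norm_decayMul_le_of_bound ha hlam zero_le_one (ae_of_all _ (norm_decay_le ha hlam))

theorem norm_decayMul_lt_one {a : ℝ} (ha : 0 < a) {lam : ℂ} (hlam : 0 < lam.re) :
    ‖decayMul ha hlam.le posI‖ < 1 := by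
  have hpos : 0 < 2 * lam.re * a := by positivity
  refine (norm_decayMul_le_of_bound ha hlam.le (c := Real.exp (-(2 * lam.re * a)))
    (Real.exp_pos _).le ?_).trans_lt (Real.exp_lt_one_iff.2 (by linarith))
  refine ae_restrict_of_forall_mem measurableSet_Ioo fun v hv => ?_
  rw [norm_decay, Real.exp_le_exp, neg_le_neg_iff, abs_of_pos hv.1, le_div_iff₀ hv.1]
  nlinarith [hv.2]

theorem measurable_decay (a : ℝ) (lam : ℂ) : Measurable (decay a lam) := by
  unfold decay
  fun_prop

theorem countable_exp_preimage_singleton (ζ : ℂ) : (Complex.exp ⁻¹' {ζ}).Countable := by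
  rcases (Complex.exp ⁻¹' {ζ}).eq_empty_or_nonempty with h | ⟨w, hw⟩
  · simp [h]
  · refine (countable_range fun n : ℤ => w + n * (2 * Real.pi * Complex.I)).mono fun z hz => ?_
    have h : Complex.exp z = Complex.exp w := hz.trans hw.symm
    obtain ⟨n, hn⟩ := Complex.exp_eq_exp_iff_exists_int.1 h
    exact ⟨n, hn.symm⟩

/-- The level sets of `v ↦ exp (-2 λ a / |v|)` are null on an interval where `|v|` is injective. -/
theorem measure_decay_preimage_singleton {a : ℝ} (ha : 0 < a) {lam : ℂ} (hlam : lam ≠ 0)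
    {J : Set ℝ} (hJ : InjOn (fun v : ℝ => |v|) J) (ζ : ℂ) :
    volume.restrict J (decay a lam ⁻¹' {ζ}) = 0 := by
  rw [Measure.restrict_apply (measurable_decay a lam (measurableSet_singleton ζ))]
  refine Countable.measure_zero ?_ _
  -- The exponent is injective in `v` on `J`, and a fibre of `exp` is countable.
  refine MapsTo.countable_of_injOn (f := fun v : ℝ => -(2 * lam * a / ((|v| : ℝ) : ℂ)))
    (t := Complex.exp ⁻¹' {ζ}) (fun v hv => hv.1) ?_ (countable_exp_preimage_singleton ζ)
  intro v hv w hw h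
  have hla : 2 * lam * (a : ℂ) ≠ 0 :=
    mul_ne_zero (mul_ne_zero two_ne_zero hlam) (by exact_mod_cast ha.ne')
  refine hJ hv.2 hw.2 ?_
  have h1 := neg_injective h
  rw [div_eq_mul_inv, div_eq_mul_inv] at h1
  exact_mod_cast inv_injective (mul_left_cancel₀ hla h1)

theorem injOn_abs_posI : InjOn (fun v : ℝ => |v|) posI := fun v hv w hw h => by
  simpa [abs_of_pos hv.1, abs_of_pos hw.1] using h

theorem injOn_abs_negI : InjOn (fun v : ℝ => |v|) negI := fun v hv w hw h => by
  simpa [abs_of_neg hv.2, abs_of_neg hw.2] using h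

theorem decay_mul_decay (a : ℝ) (lam : ℂ) (v : ℝ) :
    decay a lam v * decay a lam v = decay a (2 * lam) v := by
  rw [decay, decay, ← Complex.exp_add]
  congr 1
  ring

theorem coeFn_decayMul_decayMul {a : ℝ} (ha : 0 < a) {lam : ℂ} (hlam : 0 ≤ lam.re) (I : Set ℝ)
    (f : L1 I) :
    (decayMul ha hlam I).comp (decayMul ha hlam I) f =ᵐ[volume.restrict I]
      fun v => decay a (2 * lam) v * f v := by
  filter_upwards [coeFn_decayMul ha hlam I f, coeFn_decayMul ha hlam I (decayMul ha hlam I f)]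
    with v h1 h2
  rw [ContinuousLinearMap.comp_apply, h2, h1, ← mul_assoc, decay_mul_decay]

theorem norm_decay_of_re_eq_zero (a : ℝ) {lam : ℂ} (h : lam.re = 0) (v : ℝ) :
    ‖decay a lam v‖ = 1 := by
  simp [norm_decay, h]

/-! ### Spectral radius bounds and the case distinction. -/

theorem spectralRadius_lt_one_of_norm_pow_lt_one {E : Type*} [NormedAddCommGroup E]
    [NormedSpace ℂ E] [CompleteSpace E] (T : E →L[ℂ] E) (n : ℕ) (h : ‖T ^ (n + 1)‖ < 1) :
    spectralRadius ℂ T < 1 := by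
  refine (spectrum.spectralRadius_le_pow_nnnorm_pow_one_div ℂ T n).trans_lt ?_
  have h1 : ((‖(1 : E →L[ℂ] E)‖₊ : ℝ≥0∞)) ≤ 1 := by
    exact_mod_cast ContinuousLinearMap.norm_id_le (𝕜 := ℂ) (E := E)
  have h2 : ((‖T ^ (n + 1)‖₊ : ℝ≥0∞)) < 1 := by exact_mod_cast h
  have hn : (0 : ℝ) < 1 / (n + 1) := by positivity
  calc _ ≤ (‖T ^ (n + 1)‖₊ : ℝ≥0∞) ^ (1 / (n + 1) : ℝ) * 1 := by
        gcongr
        exact ENNReal.rpow_le_one h1 hn.le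
    _ < 1 := by
        rw [mul_one]
        exact ENNReal.rpow_lt_one h2 hn

theorem spectralRadius_lt_one_of_norm_lt_one {E : Type*} [NormedAddCommGroup E]
    [NormedSpace ℂ E] [CompleteSpace E] (T : E →L[ℂ] E) (h : ‖T‖ < 1) :
    spectralRadius ℂ T < 1 :=
  spectralRadius_lt_one_of_norm_pow_lt_one T 0 (by simpa using h)

theorem norm_comp_lt_one {E F H : Type*} [NormedAddCommGroup E] [NormedSpace ℂ E]
    [NormedAddCommGroup F] [NormedSpace ℂ F] [NormedAddCommGroup H] [NormedSpace ℂ H]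
    {S : F →L[ℂ] H} {T : E →L[ℂ] F} (hS : ‖S‖ < 1) (hT : ‖T‖ ≤ 1) : ‖S.comp T‖ < 1 :=
  (S.opNorm_comp_le T).trans_lt
    ((mul_le_of_le_one_right (norm_nonneg _) hT).trans_lt hS)

theorem norm_comp_lt_one' {E F H : Type*} [NormedAddCommGroup E] [NormedSpace ℂ E]
    [NormedAddCommGroup F] [NormedSpace ℂ F] [NormedAddCommGroup H] [NormedSpace ℂ H]
    {S : F →L[ℂ] H} {T : E →L[ℂ] F} (hS : ‖S‖ ≤ 1) (hT : ‖T‖ < 1) : ‖S.comp T‖ < 1 :=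
  (S.opNorm_comp_le T).trans_lt
    ((mul_le_of_le_one_left (norm_nonneg _) hS).trans_lt hT)

theorem norm_comp_le_one {E F H : Type*} [NormedAddCommGroup E] [NormedSpace ℂ E]
    [NormedAddCommGroup F] [NormedSpace ℂ F] [NormedAddCommGroup H] [NormedSpace ℂ H]
    {S : F →L[ℂ] H} {T : E →L[ℂ] F} (hS : ‖S‖ ≤ 1) (hT : ‖T‖ ≤ 1) : ‖S.comp T‖ ≤ 1 :=
  (S.opNorm_comp_le T).trans (mul_le_one₀ hS (norm_nonneg _) hT)

theorem IsStochastic.opNorm_le {I J : Set ℝ} {K : L1 I →L[ℂ] L1 J} (hK : IsStochastic K) :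
    ‖K‖ ≤ 1 :=
  ContinuousLinearMap.opNorm_le_bound _ zero_le_one fun f => by simpa using hK.norm_le f

/-- The case where both boundary operators are spreading. -/
theorem spectralRadius_lt_one_of_isSpreading {a : ℝ} (ha : 0 < a) {lam : ℂ} (hlam : 0 ≤ lam.re)
    (hre : lam.re = 0) (hlam0 : lam ≠ 0) {P : L1 negI →L[ℂ] L1 posI} {Q : L1 posI →L[ℂ] L1 negI}
    (hP : IsStochastic P) (hP' : IsSpreading P) (hQ : IsStochastic Q) (hQ' : IsSpreading Q) :
    spectralRadius ℂ
      (P.comp ((decayMul ha hlam negI).comp (Q.comp (decayMul ha hlam posI)))) < 1 := by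
  refine spectralRadius_lt_one_of_norm_lt_one _ ?_
  have key : ‖P.comp ((decayMul ha hlam negI).comp Q)‖ < 1 :=
    norm_comp_mul_comp_lt_one hP hP' hQ hQ' (measurable_decay a lam) (norm_decay_of_re_eq_zero a hre)
      (measure_decay_preimage_singleton ha hlam0 injOn_abs_negI) (decayMul ha hlam negI)
      (coeFn_decayMul ha hlam negI)
  have h := norm_comp_lt_one key (norm_decayMul_le ha hlam posI)
  rwa [ContinuousLinearMap.comp_assoc, ContinuousLinearMap.comp_assoc] at h

/-- The case where the operator at `x = -a` is the specular reflection. -/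
theorem spectralRadius_R₁_lt_one {a : ℝ} (ha : 0 < a) {lam : ℂ} (hlam : 0 ≤ lam.re)
    (hre : lam.re = 0) (hlam0 : lam ≠ 0) {Q : L1 posI →L[ℂ] L1 negI}
    (hQ : IsStochastic Q) (hQ' : IsSpreading Q) :
    spectralRadius ℂ
      (R₁.comp ((decayMul ha hlam negI).comp (Q.comp (decayMul ha hlam posI)))) < 1 := by
  refine spectralRadius_lt_one_of_norm_pow_lt_one _ 1 ?_
  -- With `D` the multiplier, `G² = R₁ D (Q R₁) D² Q D`, and `D²` is the multiplier for `2λ`. The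
  -- middle block `(Q R₁) D² Q` is a strict contraction.
  have key := norm_comp_mul_comp_lt_one (hQ.comp isStochastic_R₁) (hQ'.comp isStochastic_R₁) hQ hQ'
    (measurable_decay a (2 * lam)) (norm_decay_of_re_eq_zero a (by simp [hre]))
    (measure_decay_preimage_singleton ha (mul_ne_zero two_ne_zero hlam0) injOn_abs_negI)
    _ (coeFn_decayMul_decayMul ha hlam negI)
  refine lt_of_le_of_lt (le_of_eq (congrArg _ ?_))
    (norm_comp_lt_one' isStochastic_R₁.opNorm_le (norm_comp_lt_one'
      (norm_decayMul_le ha hlam negI) (norm_comp_lt_one key (norm_decayMul_le ha hlam posI))))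
  ext1 f
  simp only [pow_succ, pow_zero, one_mul, mul_apply_eq_comp,
    ContinuousLinearMap.comp_apply, decayMul_R₁]

/-- The case where the operator at `x = a` is the specular reflection. -/
theorem spectralRadius_R₂_lt_one {a : ℝ} (ha : 0 < a) {lam : ℂ} (hlam : 0 ≤ lam.re)
    (hre : lam.re = 0) (hlam0 : lam ≠ 0) {P : L1 negI →L[ℂ] L1 posI}
    (hP : IsStochastic P) (hP' : IsSpreading P) :
    spectralRadius ℂ
      (P.comp ((decayMul ha hlam negI).comp (R₂.comp (decayMul ha hlam posI)))) < 1 := by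
  refine spectralRadius_lt_one_of_norm_pow_lt_one _ 1 ?_
  -- Here `G² = (P R₂) D² P D R₂ D`, with `D²` acting on `(0, 1)`.
  have key := norm_comp_mul_comp_lt_one (hP.comp isStochastic_R₂) (hP'.comp isStochastic_R₂) hP hP'
    (measurable_decay a (2 * lam)) (norm_decay_of_re_eq_zero a (by simp [hre]))
    (measure_decay_preimage_singleton ha (mul_ne_zero two_ne_zero hlam0) injOn_abs_posI)
    _ (coeFn_decayMul_decayMul ha hlam posI)
  refine lt_of_le_of_lt (le_of_eq (congrArg _ ?_))
    (norm_comp_lt_one key (norm_comp_le_one (norm_decayMul_le ha hlam negI)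
      (norm_comp_le_one isStochastic_R₂.opNorm_le (norm_decayMul_le ha hlam posI))))
  ext1 f
  simp only [pow_succ, pow_zero, one_mul, mul_apply_eq_comp,
    ContinuousLinearMap.comp_apply, decayMul_R₂]

end SlabTransport

theorem mainTheorem3 (a : ℝ) (ha : 0 < a) (α₁ β₁ α₂ β₂ : ℝ)
    (hα₁ : 0 ≤ α₁) (hβ₁ : 0 ≤ β₁) (h₁ : α₁ + β₁ = 1)
    (hα₂ : 0 ≤ α₂) (hβ₂ : 0 ≤ β₂) (h₂ : α₂ + β₂ = 1)
    (K₁ : SlabTransport.L1 SlabTransport.negI →L[ℂ] SlabTransport.L1 SlabTransport.posI)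
    (K₂ : SlabTransport.L1 SlabTransport.posI →L[ℂ] SlabTransport.L1 SlabTransport.negI)
    (hK₁ : SlabTransport.IsStochastic K₁) (hK₂ : SlabTransport.IsStochastic K₂)
    (hwK₁ : SlabTransport.IsWeaklyCompactOperator K₁)
    (hwK₂ : SlabTransport.IsWeaklyCompactOperator K₂)
    (hβ : 0 < β₁ + β₂)
    (lam : ℂ) (hlam : 0 ≤ lam.re) (hlam0 : lam ≠ 0) :
    spectralRadius ℂ (SlabTransport.G ha α₁ β₁ α₂ β₂ K₁ K₂ hlam) < 1 := by
  open SlabTransport in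
  have hO₁ : IsStochastic (O₁ α₁ β₁ K₁) := isStochastic_R₁.convex hK₁ hα₁ hβ₁ h₁
  have hO₂ : IsStochastic (O₂ α₂ β₂ K₂) := isStochastic_R₂.convex hK₂ hα₂ hβ₂ h₂
  have hS₁ : 0 < β₁ → IsSpreading (O₁ α₁ β₁ K₁) := fun h =>
    (hK₁.isSpreading hwK₁).convex isStochastic_R₁ hα₁ h h₁
  have hS₂ : 0 < β₂ → IsSpreading (O₂ α₂ β₂ K₂) := fun h =>
    (hK₂.isSpreading hwK₂).convex isStochastic_R₂ hα₂ h h₂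
  unfold G
  rcases hlam.lt_or_eq with hre | hre
  · refine spectralRadius_lt_one_of_norm_lt_one _ ?_
    exact norm_comp_lt_one' hO₁.opNorm_le (norm_comp_lt_one' (norm_decayMul_le ha hlam negI)
      (norm_comp_lt_one' hO₂.opNorm_le (norm_decayMul_lt_one ha hre)))
  rcases hβ₁.lt_or_eq with hb₁ | hb₁
  · rcases hβ₂.lt_or_eq with hb₂ | hb₂
    · exact spectralRadius_lt_one_of_isSpreading ha hlam hre.symm hlam0 hO₁ (hS₁ hb₁) hO₂ (hS₂ hb₂)
    · have e : O₂ α₂ β₂ K₂ = R₂ := by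
        have : α₂ = 1 := by linarith
        simp [O₂, ← hb₂, this]
      rw [e]
      exact spectralRadius_R₂_lt_one ha hlam hre.symm hlam0 hO₁ (hS₁ hb₁)
  · have e : O₁ α₁ β₁ K₁ = R₁ := by
      have : α₁ = 1 := by linarith
      simp [O₁, ← hb₁, this]
    rw [e]
    exact spectralRadius_R₁_lt_one ha hlam hre.symm hlam0 hO₂ (hS₂ (by linarith))
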